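/- Let $\mathcal X\subset\mathbb R^k$ be a set on which gradients are unambiguous (for instance an open set, or a convex set with non-empty interior), let $\mathcal Y$ be a measurable space (e.g. a subset of a Euclidean space), $\ell:\mathcal Y\times\mathcal Y\to[0,\infty)$ a loss, $d_x$ a (pseudo)metric on $\mathcal X$, $\lambda\ge 0$, $T>0$, $\alpha\in(0,1)$ and $\delta\in\mathbb R$. For a model $f:\mathcal X\to\mathcal Y$ and $(x_0,y_0)\in\mathcal X\times\mathcal Y$ let $X:[0,T]\to\mathcal X$ be the solution of $$\dot X(t)=\nabla_x\{\ell(f(X(t)),y_0)-\lambda d_x^2(X(t),x_0)\},\qquad X(0)=x_0,$$ and put $\Phi(x_0,y_0)=X(T)$ (with the convention $\Phi(x_0,y_0)=x_0$ if there is no solution staying in $\mathcal X$ up to time $T$). Write $r_f(x,y)=\ell(f(\Phi(x,y)),y)/\ell(f(x),y)$, and for a probability measure $P$ on $\mathcal X\times\mathcal Y$ call $\tau(f)=\mathbb E_P[r_f(x,y)]$ the audit value of $f$. Let $(x_1,y_1),(x_2,y_2),\dots$ be i.i.d. from $P$ and let the model $f$, which may be random through a parameter, be independent of $\{(x_i,y_i)\}_{i\ge1}$.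 Assume that, almost surely with respect to $f$: for every $(x_0,y_0)$ the function $x\mapsto \ell(f(x),y_0)-\lambda d_x^2(x,x_0)$ is differentiable on $\mathcal X$ with Lipschitz gradient; $\ell(f(x),y)>0$ for $P$-almost every $(x,y)$; and $r_f$ has finite first and second moments under $P$. (The loss ratio is assumed measurable in $(x,y)$ and the parameter of $f$ jointly.) Let $$S_n=\frac1n\sum_{i=1}^n r_f(x_i,y_i),\qquad V_n^2=\frac1{n-1}\sum_{i=1}^n\bigl(r_f(x_i,y_i)-S_n\bigr)^2,\qquad T_n=S_n-\frac{z_{1-\alpha}}{\sqrt n}V_n,$$ where $V_n\ge0$ and $z_q$ is the $q$-th quantile of $\mathcal N(0,1)$; the test rejects when $T_n>\delta$. Then: 1. if $\tau(f)\le\delta$ almost surely, then $\lim_{n\to\infty}\mathbb P(T_n>\delta)$ exists and is at most $\alpha$; 2. if $\tau(f)>\delta$ almost surely, then $\lim_{n\to\infty}\mathbb P(T_n>\delta)=1$. Moreover both hold conditionally on the model: almost surely, $\lim_{n\to\infty}\mathbb P(T_n>\delta\mid f)$ exists and is at most $\alpha$ if $\tau(f)\le\delta$, and equals $1$ if $\tau(f)>\delta$,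 where conditioning on $f$ means conditioning on its parameter. For a non-random model $f$ the words "almost surely" are void and 1 and 2 are the whole statement. -/

import Mathlib

open Set Filter Topology MeasureTheory ProbabilityTheory
open scoped NNReal

noncomputable section

/-- The laws of a fair metric: a (pseudo)metric, so that distinct points may be at distance `0`. -/
structure IsFairMetric {S : Type*} (d : S → S → ℝ) : Prop where
  nonneg : ∀ x x', 0 ≤ d x x'
  self : ∀ x, d x x = 0
  symm : ∀ x x', d x x' = d x' x
  triangle : ∀ x x' x'', d x x'' ≤ d x x' + d x' x''

section Attack

variable {k : ℕ} {X : Set (EuclideanSpace ℝ (Fin k))} {Y : Type*}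

/-- The regularized loss `x ↦ ℓ(f(x), y₀) - lam * d(x, x₀)²` on the feature space `X`. -/
def attackObjective (loss : Y → Y → ℝ) (f : X → Y) (d : X → X → ℝ) (lam : ℝ)
    (x₀ : X) (y₀ : Y) : X → ℝ :=
  fun x => loss (f x) y₀ - lam * d x x₀ ^ 2

/-- The regularized loss as a function on the ambient space: outside `X` it is set to `0`, and
below it is only differentiated within `X` at points of `X`, so those values play no role. -/
def attackObjectiveExt (loss : Y → Y → ℝ) (f : X → Y) (d : X → X → ℝ) (lam : ℝ)
    (x₀ : X) (y₀ : Y) : EuclideanSpace ℝ (Fin k) → ℝ :=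
  Function.extend Subtype.val (attackObjective loss f d lam x₀ y₀) 0

/-- The gradient in `x` of the regularized loss, at points of `X`. -/
def attackField (loss : Y → Y → ℝ) (f : X → Y) (d : X → X → ℝ) (lam : ℝ)
    (x₀ : X) (y₀ : Y) : EuclideanSpace ℝ (Fin k) → EuclideanSpace ℝ (Fin k) :=
  fun x => gradientWithin (attackObjectiveExt loss f d lam x₀ y₀) X x

/-- For every `(x₀, y₀)` the regularized loss is differentiable on `X` and its gradient is
Lipschitz on `X` (the Lipschitz constant may depend on `(x₀, y₀)`). -/
def HasLipschitzGradient (loss : Y → Y → ℝ) (f : X → Y) (d : X → X → ℝ) (lam : ℝ) : Prop :=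
  ∀ (x₀ : X) (y₀ : Y),
    DifferentiableOn ℝ (attackObjectiveExt loss f d lam x₀ y₀) X ∧
    ∃ L : ℝ≥0, LipschitzOnWith L (attackField loss f d lam x₀ y₀) X

/-- `γ` is a solution in `X`, over the time interval `[0, T]`, of the gradient flow attack
`γ' = ∇ₓ (ℓ(f(γ), y₀) - lam * d(γ, x₀)²)`, `γ(0) = x₀`. -/
def IsGradientFlowAttack (loss : Y → Y → ℝ) (f : X → Y) (d : X → X → ℝ) (lam T : ℝ)
    (x₀ : X) (y₀ : Y) (γ : ℝ → X) : Prop :=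
  γ 0 = x₀ ∧ ∀ t ∈ Icc (0 : ℝ) T,
    HasDerivWithinAt (fun s => (γ s : EuclideanSpace ℝ (Fin k)))
      (attackField loss f d lam x₀ y₀ (γ t)) (Icc (0 : ℝ) T) t

open Classical in
/-- The unfair map: the value at time `T` of the gradient flow attack started at `x₀`
(and `x₀` itself if the attack has no solution in `X` on `[0, T]`). -/
def unfairMap (loss : Y → Y → ℝ) (f : X → Y) (d : X → X → ℝ) (lam T : ℝ) (z : X × Y) : X :=
  if h : ∃ γ : ℝ → X, IsGradientFlowAttack loss f d lam T z.1 z.2 γ then h.choose T else z.1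

/-- Under the Lipschitz condition the unfair map is the end point of every solution. -/
theorem unfairMap_eq {loss : Y → Y → ℝ} {f : X → Y} {d : X → X → ℝ} {lam T : ℝ} (hT : 0 ≤ T)
    (hL : HasLipschitzGradient loss f d lam) {z : X × Y} {γ : ℝ → X}
    (hγ : IsGradientFlowAttack loss f d lam T z.1 z.2 γ) :
    unfairMap loss f d lam T z = γ T := by
  have h : ∃ γ : ℝ → X, IsGradientFlowAttack loss f d lam T z.1 z.2 γ := ⟨γ, hγ⟩
  rw [unfairMap, dif_pos h]
  obtain ⟨-, L, hLip⟩ := hL z.1 z.2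
  have hc := h.choose_spec
  have right : ∀ η : ℝ → X, IsGradientFlowAttack loss f d lam T z.1 z.2 η →
      ∀ t ∈ Ico (0 : ℝ) T, HasDerivWithinAt (fun s => (η s : EuclideanSpace ℝ (Fin k)))
        (attackField loss f d lam z.1 z.2 (η t)) (Ici t) t := by
    intro η hη t ht
    exact (hη.2 t ⟨ht.1, ht.2.le⟩).mono_of_mem_nhdsWithin (Icc_mem_nhdsGE_of_mem ht)
  have key := ODE_solution_unique_of_mem_Icc_right
    (v := fun _ => attackField loss f d lam z.1 z.2) (s := fun _ => X) (K := L)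
    (fun _ _ => hLip)
    (fun t ht => (hc.2 t ht).continuousWithinAt) (right _ hc) (fun t _ => (h.choose t).2)
    (fun t ht => (hγ.2 t ht).continuousWithinAt) (right _ hγ) (fun t _ => (γ t).2)
    (by rw [hc.1, hγ.1])
  exact Subtype.ext (key ⟨hT, le_rfl⟩)

/-- The loss ratio `ℓ(f(Φ(x, y)), y) / ℓ(f(x), y)`, where `Φ` is the unfair map. -/
def lossRatio (loss : Y → Y → ℝ) (f : X → Y) (d : X → X → ℝ) (lam T : ℝ) (z : X × Y) : ℝ :=
  loss (f (unfairMap loss f d lam T z)) z.2 / loss (f z.1) z.2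

/-- The audit value: the expectation of the loss ratio under `P`. -/
def auditValue [MeasurableSpace Y] (loss : Y → Y → ℝ) (f : X → Y) (d : X → X → ℝ)
    (lam T : ℝ) (P : Measure (X × Y)) : ℝ :=
  ∫ z, lossRatio loss f d lam T z ∂P

end Attack

/-- The empirical mean of `r 0, …, r (n - 1)`. -/
def sampleMean (r : ℕ → ℝ) (n : ℕ) : ℝ :=
  (∑ i ∈ Finset.range n, r i) / n

/-- The empirical variance of `r 0, …, r (n - 1)`, with normalization `n - 1`. -/
def sampleVar (r : ℕ → ℝ) (n : ℕ) : ℝ :=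
  (∑ i ∈ Finset.range n, (r i - sampleMean r n) ^ 2) / ((n : ℝ) - 1)

/-- The `q`-th quantile of the standard normal distribution. -/
def normalQuantile (q : ℝ) : ℝ :=
  sInf {x : ℝ | q ≤ cdf (gaussianReal 0 1) x}

/-- The test statistic `Sₙ - z_{1-α} Vₙ / √n` computed from `r 0, …, r (n - 1)`. -/
def testStatistic (α : ℝ) (r : ℕ → ℝ) (n : ℕ) : ℝ :=
  sampleMean r n - normalQuantile (1 - α) / √(n : ℝ) * √(sampleVar r n)

/-- The event that the test with tolerance `δ` and level `α`, computed from the first `n` audit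
points `Z 0, …, Z (n - 1)` for the (possibly random) model `F`, rejects. -/
def rejectionEvent {k : ℕ} {X : Set (EuclideanSpace ℝ (Fin k))} {Y Ω : Type*}
    (loss : Y → Y → ℝ) (d : X → X → ℝ) (lam T α δ : ℝ)
    (F : Ω → X → Y) (Z : ℕ → Ω → X × Y) (n : ℕ) : Set Ω :=
  {ω | δ < testStatistic α (fun i => lossRatio loss (F ω) d lam T (Z i ω)) n}

end

/-! For a frozen model the loss ratios are i.i.d. and square integrable, so the claim is about a
one-sided z-test with estimated variance. By the strong law the statistic tends a.s. to `τ`; if `τ ≠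
δ`, the rejection probability therefore tends to 0 or 1 (`tendsto_measureReal_reject_of_ne`). If `τ
= δ` and the variance `σ²` is positive, the CLT and Slutsky give `√n (Tₙ - δ) → σ (N - z)` in law
with `N` standard normal, and `P(N > z) ≤ α` (`tendsto_measureReal_reject_of_eq`). If `σ = 0`, the
statistic is a.s. equal to `δ` and the strict inequality fails. For a random model, independence
identifies the conditional rejection probability given `θ` with the frozen-model one
(`condExp_indicator_preimage_of_indepFun`); dominated convergence then yields the unconditional
limits. -/

/-! ### Deterministic facts on sample mean, sample variance and test statistic. -/

theorem sum_sub_sampleMean_sq (r : ℕ → ℝ) {n : ℕ} (hn : n ≠ 0) :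
    ∑ i ∈ Finset.range n, (r i - sampleMean r n) ^ 2
      = n * (sampleMean (fun i => r i ^ 2) n - sampleMean r n ^ 2) := by
  have hn' : (n : ℝ) ≠ 0 := Nat.cast_ne_zero.2 hn
  have h1 : ∑ i ∈ Finset.range n, r i = n * sampleMean r n := by
    rw [sampleMean]; field_simp
  have h2 : ∑ i ∈ Finset.range n, r i ^ 2 = n * sampleMean (fun i => r i ^ 2) n := by
    rw [sampleMean]; field_simp
  have h3 : ∀ i, (r i - sampleMean r n) ^ 2
      = r i ^ 2 - 2 * sampleMean r n * r i + sampleMean r n ^ 2 := fun i => by ring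
  simp_rw [h3, Finset.sum_add_distrib, Finset.sum_sub_distrib, ← Finset.mul_sum, h1, h2]
  simp
  ring

theorem tendsto_sampleVar {r : ℕ → ℝ} {m s : ℝ} (h1 : Tendsto (sampleMean r) atTop (𝓝 m))
    (h2 : Tendsto (sampleMean fun i => r i ^ 2) atTop (𝓝 s)) :
    Tendsto (sampleVar r) atTop (𝓝 (s - m ^ 2)) := by
  -- The factor `n / (n - 1)` by which `sampleVar` differs from mean of squares minus squared mean.
  have h3 : Tendsto (fun n : ℕ => (n : ℝ) / ((n : ℝ) + (-1))) atTop (𝓝 1) :=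
    tendsto_natCast_div_add_atTop (-1)
  have h4 := h3.mul (h2.sub (h1.pow 2))
  rw [one_mul] at h4
  refine h4.congr' ?_
  filter_upwards [eventually_ne_atTop 0] with n hn
  rw [sampleVar, sum_sub_sampleMean_sq r hn]
  ring

@[fun_prop]
theorem measurable_sampleMean (n : ℕ) : Measurable fun r : ℕ → ℝ => sampleMean r n := by
  unfold sampleMean; fun_prop

@[fun_prop]
theorem measurable_sampleVar (n : ℕ) : Measurable fun r : ℕ → ℝ => sampleVar r n := by
  unfold sampleVar; fun_prop

@[fun_prop]
theorem measurable_testStatistic (α : ℝ) (n : ℕ) :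
    Measurable fun r : ℕ → ℝ => testStatistic α r n := by
  unfold testStatistic; fun_prop

theorem testStatistic_const (α c : ℝ) {n : ℕ} (hn : n ≠ 0) :
    testStatistic α (fun _ => c) n = c := by
  have : (n : ℝ) ≠ 0 := Nat.cast_ne_zero.2 hn
  have hm : sampleMean (fun _ => c) n = c := by simp [sampleMean]; field_simp
  simp [testStatistic, sampleVar, hm]

theorem tendsto_testStatistic (α : ℝ) {r : ℕ → ℝ} {m v : ℝ}
    (h1 : Tendsto (sampleMean r) atTop (𝓝 m)) (h2 : Tendsto (sampleVar r) atTop (𝓝 v)) :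
    Tendsto (testStatistic α r) atTop (𝓝 m) := by
  have h3 : Tendsto (fun n : ℕ => normalQuantile (1 - α) / √(n : ℝ)) atTop (𝓝 0) :=
    tendsto_const_nhds.div_atTop (Real.tendsto_sqrt_atTop.comp tendsto_natCast_atTop_atTop)
  simpa [testStatistic] using! h1.sub (h3.mul h2.sqrt)

/-! ### The normal quantile. -/

/-- Right continuity of the cdf puts the infimum itself in the superlevel set. This inequality
suffices to bound the upper tail by `α`. -/
theorem le_cdf_normalQuantile {q : ℝ} (h0 : 0 < q) (h1 : q < 1) :
    q ≤ cdf (gaussianReal 0 1) (normalQuantile q) := by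
  set S := {x : ℝ | q ≤ cdf (gaussianReal 0 1) x}
  have hne : S.Nonempty := ((tendsto_cdf_atTop _).eventually_const_le h1).exists
  have hbdd : BddBelow S := by
    obtain ⟨b, hb⟩ := ((tendsto_cdf_atBot (gaussianReal 0 1)).eventually_lt_const h0).exists
    refine ⟨b, fun x hx => le_of_not_gt fun hxb => ?_⟩
    exact absurd ((monotone_cdf _ hxb.le).trans_lt hb) (not_lt.2 hx)
  have hright : Tendsto (cdf (gaussianReal 0 1)) (𝓝[>] sInf S)
      (𝓝 (cdf (gaussianReal 0 1) (sInf S))) :=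
    ((cdf (gaussianReal 0 1)).right_continuous (sInf S)).mono Ioi_subset_Ici_self
  refine ge_of_tendsto hright ?_
  filter_upwards [self_mem_nhdsWithin] with x hx
  obtain ⟨y, hy, hyx⟩ := exists_lt_of_csInf_lt hne hx
  exact le_trans hy (monotone_cdf _ hyx.le)

theorem gaussianReal_Ioi_normalQuantile_le {α : ℝ} (hα : α ∈ Ioo (0 : ℝ) 1) :
    (gaussianReal 0 1).real (Ioi (normalQuantile (1 - α))) ≤ α := by
  have h := le_cdf_normalQuantile (q := 1 - α) (by linarith [hα.2]) (by linarith [hα.1])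
  rw [cdf_eq_real] at h
  rw [← compl_Iic, probReal_compl_eq_one_sub measurableSet_Iic]
  linarith

/-! ### The z-test for i.i.d. square-integrable variables. -/

section IID

variable {Ω : Type*} [MeasurableSpace Ω] {μ : Measure Ω} [IsProbabilityMeasure μ]
  {ξ : ℕ → Ω → ℝ}

theorem ae_tendsto_sampleMean_sampleVar (hindep : iIndepFun ξ μ)
    (hident : ∀ i, IdentDistrib (ξ i) (ξ 0) μ μ) (hL2 : MemLp (ξ 0) 2 μ) :
    ∀ᵐ ω ∂μ, Tendsto (sampleMean fun i => ξ i ω) atTop (𝓝 μ[ξ 0]) ∧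
      Tendsto (sampleVar fun i => ξ i ω) atTop (𝓝 Var[ξ 0; μ]) := by
  have h1 := strong_law_ae_real ξ (hL2.integrable one_le_two)
    (fun i j hij => hindep.indepFun hij) hident
  have h2 := strong_law_ae_real (fun i ω => ξ i ω ^ 2) hL2.integrable_sq
    (fun i j hij => (hindep.indepFun hij).comp (measurable_id.pow_const 2)
      (measurable_id.pow_const 2)) (fun i => (hident i).comp (measurable_id.pow_const 2))
  filter_upwards [h1, h2] with ω hω1 hω2
  refine ⟨hω1, ?_⟩
  rw [variance_eq_sub hL2]
  exact tendsto_sampleVar hω1 hω2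

theorem tendsto_measureReal_reject_of_ne (α : ℝ) {δ : ℝ} (hm : ∀ i, Measurable (ξ i))
    (hindep : iIndepFun ξ μ) (hident : ∀ i, IdentDistrib (ξ i) (ξ 0) μ μ)
    (hL2 : MemLp (ξ 0) 2 μ) (hδ : μ[ξ 0] ≠ δ) :
    Tendsto (fun n => μ.real {ω | δ < testStatistic α (fun i => ξ i ω) n}) atTop
      (𝓝 (if δ < μ[ξ 0] then 1 else 0)) := by
  have hmeas : ∀ n, MeasurableSet {ω | δ < testStatistic α (fun i => ξ i ω) n} := fun n =>
    measurableSet_lt measurable_const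
      ((measurable_testStatistic α n).comp (measurable_pi_lambda _ hm))
  have hae := ae_tendsto_sampleMean_sampleVar hindep hident hL2
  -- Almost sure stabilization of the rejection indicators forces convergence of their
  -- probabilities; it is applied to `univ` and `∅`.
  have key : ∀ A : Set Ω, MeasurableSet A →
      (∀ᵐ ω ∂μ, ∀ᶠ n in atTop, ω ∈ {ω | δ < testStatistic α (fun i => ξ i ω) n} ↔ ω ∈ A) →
      Tendsto (fun n => μ.real {ω | δ < testStatistic α (fun i => ξ i ω) n}) atTop
        (𝓝 (μ.real A)) := fun A hA h =>
    (ENNReal.tendsto_toReal (by finiteness)).comp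
      (tendsto_measure_of_ae_tendsto_indicator_of_isFiniteMeasure _ hA hmeas h)
  split_ifs with h
  · convert! key univ MeasurableSet.univ ?_
    · simp
    · filter_upwards [hae] with ω hω
      filter_upwards [(tendsto_testStatistic α hω.1 hω.2).eventually_const_lt h] with n hn
      simpa using hn
  · convert! key ∅ MeasurableSet.empty ?_
    · simp
    · filter_upwards [hae] with ω hω
      filter_upwards [(tendsto_testStatistic α hω.1 hω.2).eventually_lt_const
        (lt_of_le_of_ne (not_lt.1 h) hδ)] with n hn
      simpa using hn.le

theorem tendsto_measureReal_reject_of_eq (α : ℝ) {δ : ℝ} (hm : ∀ i, Measurable (ξ i))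
    (hindep : iIndepFun ξ μ) (hident : ∀ i, IdentDistrib (ξ i) (ξ 0) μ μ)
    (hL2 : MemLp (ξ 0) 2 μ) (hδ : μ[ξ 0] = δ) (hv : Var[ξ 0; μ] ≠ 0) :
    Tendsto (fun n => μ.real {ω | δ < testStatistic α (fun i => ξ i ω) n}) atTop
      (𝓝 ((gaussianReal 0 1).real (Ioi (normalQuantile (1 - α))))) := by
  set v := Var[ξ 0; μ] with hv_def
  set z := normalQuantile (1 - α) with hz
  have hv0 : 0 < v := lt_of_le_of_ne (variance_nonneg _ _) hv.symm
  have hs0 : 0 < √v := Real.sqrt_pos.2 hv0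
  -- The CLT limit is realized on the line with standard Gaussian measure, so that the limiting
  -- rejection event becomes an explicit half-line.
  have hlaw : HasLaw (fun x : ℝ => √v * x) (gaussianReal 0 v.toNNReal) (gaussianReal 0 1) := by
    have := gaussianReal_const_mul (X := id) (P := gaussianReal 0 1) (μ := 0) (v := 1)
      ⟨aemeasurable_id, Measure.map_id⟩ (√v)
    convert! this using 2
    · simp
    · ext; simp [hv0.le]
  have hVae : ∀ᵐ ω ∂μ, Tendsto (fun n => -z * √(sampleVar (fun i => ξ i ω) n)) atTop
      (𝓝 (-z * √v)) := by
    filter_upwards [ae_tendsto_sampleMean_sampleVar hindep hident hL2] with ω hω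
    exact (hω.2.sqrt).const_mul _
  have hVm : ∀ n, Measurable fun ω => -z * √(sampleVar (fun i => ξ i ω) n) := fun n =>
    (((measurable_sampleVar n).comp (measurable_pi_lambda _ hm)).sqrt).const_mul _
  have hclt := (tendstoInDistribution_inv_sqrt_mul_sum_sub hlaw hL2 hindep hident
    ).add_of_tendstoInMeasure_const
    (tendstoInMeasure_of_tendsto_ae (fun n => (hVm n).aestronglyMeasurable) hVae)
    (fun n => (hVm n).aemeasurable)
  have hpre : (fun x : ℝ => √v * x + -z * √v) ⁻¹' Ioi 0 = Ioi z := by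
    ext x
    have : √v * x + -z * √v = √v * (x - z) := by ring
    simp only [mem_preimage, mem_Ioi, this, mul_pos_iff_of_pos_left hs0, sub_pos]
  -- The portmanteau condition: the frontier `{0}` pulls back to `{z}`, and a nondegenerate Gaussian
  -- has no atoms.
  have hnull : (gaussianReal 0 1).map (fun x : ℝ => √v * x + -z * √v) (frontier (Ioi 0)) = 0 := by
    have : (fun x : ℝ => √v * x + -z * √v) ⁻¹' {0} = {z} := by
      ext x
      have : √v * x + -z * √v = √v * (x - z) := by ring
      simp only [mem_preimage, mem_singleton_iff, this, mul_eq_zero, hs0.ne', false_or, sub_eq_zero]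
    have := nullSingletonClass_gaussianReal (μ := 0) (v := 1) one_ne_zero
    rw [frontier_Ioi, Measure.map_apply (by fun_prop) (measurableSet_singleton _), ‹_ ⁻¹' _ = _›,
      measure_singleton]
  have hport := ProbabilityMeasure.tendsto_measure_of_null_frontier_of_tendsto' hclt.tendsto
    (E := Ioi 0) hnull
  simp only [ProbabilityMeasure.coe_mk] at hport
  rw [Measure.map_apply (by fun_prop) measurableSet_Ioi, hpre] at hport
  have hport' := (ENNReal.tendsto_toReal (measure_ne_top _ _)).comp hport
  refine hport'.congr' ?_
  filter_upwards [eventually_ne_atTop 0] with n hn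
  have hn' : (0 : ℝ) < n := Nat.cast_pos.2 (Nat.pos_of_ne_zero hn)
  have hsn : 0 < √(n : ℝ) := Real.sqrt_pos.2 hn'
  simp only [Function.comp_apply]
  rw [Measure.map_apply_of_aemeasurable (hclt.forall_aemeasurable n) measurableSet_Ioi]
  change μ.real _ = _
  congr 1
  ext ω
  simp only [mem_preimage, mem_Ioi, mem_ofPred_eq, Pi.add_apply, hδ]
  have : (√(n : ℝ))⁻¹ * (∑ k ∈ Finset.range n, ξ k ω - n * δ)
      + -z * √(sampleVar (fun i => ξ i ω) n)
      = √(n : ℝ) * (testStatistic α (fun i => ξ i ω) n - δ) := by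
    rw [testStatistic, sampleMean, ← hz]
    have h2 : (n : ℝ) = √(n : ℝ) ^ 2 := (Real.sq_sqrt hn'.le).symm
    generalize √(n : ℝ) = s at h2 hsn
    rw [h2]
    field_simp
    ring
  rw [this, mul_pos_iff_of_pos_left hsn, sub_pos]

theorem exists_tendsto_measureReal_reject {α δ : ℝ} (hα : α ∈ Ioo (0 : ℝ) 1)
    (hm : ∀ i, Measurable (ξ i)) (hindep : iIndepFun ξ μ)
    (hident : ∀ i, IdentDistrib (ξ i) (ξ 0) μ μ) (hL2 : MemLp (ξ 0) 2 μ) (hδ : μ[ξ 0] ≤ δ) :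
    ∃ p ≤ α, Tendsto (fun n => μ.real {ω | δ < testStatistic α (fun i => ξ i ω) n}) atTop
      (𝓝 p) := by
  rcases hδ.lt_or_eq with hlt | heq
  · refine ⟨0, hα.1.le, ?_⟩
    simpa only [if_neg hlt.not_gt] using
      tendsto_measureReal_reject_of_ne α hm hindep hident hL2 hlt.ne
  by_cases hv : Var[ξ 0; μ] = 0
  · refine ⟨0, hα.1.le, tendsto_const_nhds.congr' ?_⟩
    have hconst : ∀ᵐ ω ∂μ, ∀ i, ξ i ω = δ := by
      refine ae_all_iff.2 fun i => ?_
      have := ae_eq_integral_of_variance_eq_zero ((hident i).memLp_iff.2 hL2)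
        ((hident i).variance_eq.trans hv)
      rwa [(hident i).integral_eq, heq] at this
    -- At `n = 0` the statistic is `0` by the division convention, and this would reject when `δ <
    -- 0`.
    filter_upwards [eventually_ne_atTop 0] with n hn
    symm
    rw [measureReal_eq_zero_iff, ← compl_compl {ω | _}, ← mem_ae_iff]
    filter_upwards [hconst] with ω hω
    simp [hω, testStatistic_const α δ hn]
  · exact ⟨_, gaussianReal_Ioi_normalQuantile_le hα,
      tendsto_measureReal_reject_of_eq α hm hindep hident hL2 heq hv⟩

end IID

/-! ### Conditioning on an independent parameter. -/

/-- Conditional probability given `θ` of an event that depends on `θ` and on an independent `ζ`. -/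
theorem condExp_indicator_preimage_of_indepFun {Ω Θ S : Type*} {mΩ : MeasurableSpace Ω}
    [mΘ : MeasurableSpace Θ] [MeasurableSpace S] {μ : Measure Ω} [IsProbabilityMeasure μ]
    {θ : Ω → Θ} {ζ : Ω → S} (hθ : Measurable θ) (hζ : Measurable ζ) (hindep : IndepFun θ ζ μ)
    {B : Set (Θ × S)} (hB : MeasurableSet B) :
    μ⟦(fun ω => (θ ω, ζ ω)) ⁻¹' B | MeasurableSpace.comap θ mΘ⟧
      =ᵐ[μ] fun ω => μ.real {ω' | (θ ω, ζ ω') ∈ B} := by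
  have hpair : Measurable fun ω => (θ ω, ζ ω) := hθ.prodMk hζ
  have : IsProbabilityMeasure (μ.map θ) := Measure.isProbabilityMeasure_map hθ.aemeasurable
  have : IsProbabilityMeasure (μ.map ζ) := Measure.isProbabilityMeasure_map hζ.aemeasurable
  have hG : Measurable fun t => μ.real {ω' | (t, ζ ω') ∈ B} := by
    have := (measurable_measure_prodMk_left (ν := μ.map ζ) hB).ennreal_toReal
    convert! this using 2 with t
    rw [Measure.map_apply hζ (measurable_prodMk_left hB)]
    rfl
  have hint : Integrable (fun ω => μ.real {ω' | (θ ω, ζ ω') ∈ B}) μ :=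
    .of_bound (hG.comp hθ).aestronglyMeasurable 1
      (ae_of_all _ fun ω => by
        rw [Real.norm_of_nonneg measureReal_nonneg]; exact measureReal_le_one)
  refine (ae_eq_condExp_of_forall_setIntegral_eq hθ.comap_le
    ((integrable_const (1 : ℝ)).indicator (hpair hB)) (fun _ _ _ => hint.integrableOn) ?_
    (hG.comp (comap_measurable θ)).aestronglyMeasurable).symm
  rintro _ ⟨A, hA, rfl⟩ -
  have hI : Integrable (B.indicator fun _ => (1 : ℝ)) ((μ.map θ).prod (μ.map ζ)) :=
    (integrable_const 1).indicator hB
  -- Fubini for the joint law, which is a product by independence; the inner integral runs over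
  -- `univ` so as to match a rectangle `A ×ˢ univ`.
  calc ∫ ω in θ ⁻¹' A, μ.real {ω' | (θ ω, ζ ω') ∈ B} ∂μ
      = ∫ t in A, μ.real {ω' | (t, ζ ω') ∈ B} ∂(μ.map θ) :=
        (setIntegral_map hA hG.aestronglyMeasurable hθ.aemeasurable).symm
    _ = ∫ t in A, ∫ s in univ, B.indicator (fun _ => (1 : ℝ)) (t, s) ∂(μ.map ζ) ∂(μ.map θ) := by
        congr with t
        have : (fun s => B.indicator (fun _ => (1 : ℝ)) (t, s))
            = (Prod.mk t ⁻¹' B).indicator 1 := rfl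
        rw [setIntegral_univ, this, integral_indicator_one (measurable_prodMk_left hB),
          map_measureReal_apply hζ (measurable_prodMk_left hB)]
        rfl
    _ = ∫ p in A ×ˢ univ, B.indicator (fun _ => (1 : ℝ)) p ∂((μ.map θ).prod (μ.map ζ)) :=
        (setIntegral_prod _ hI.integrableOn).symm
    _ = ∫ ω in θ ⁻¹' A, ((fun ω => (θ ω, ζ ω)) ⁻¹' B).indicator (fun _ => (1 : ℝ)) ω ∂μ := by
        rw [← (indepFun_iff_map_prod_eq_prod_map_map hθ.aemeasurable hζ.aemeasurable).1 hindep]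
        rw [setIntegral_map (hA.prod .univ)
          (stronglyMeasurable_const.indicator hB).aestronglyMeasurable hpair.aemeasurable]
        congr 2
        ext ω; simp

/-- If the conditional probabilities of `E n` converge almost surely to `G`, then the probabilities
of `E n` converge to the expectation of `G`. -/
theorem tendsto_measureReal_of_condExp {Ω : Type*} {m mΩ : MeasurableSpace Ω}
    {μ : Measure Ω} [IsProbabilityMeasure μ] (hm : m ≤ mΩ) {E : ℕ → Set Ω}
    (hE : ∀ n, NullMeasurableSet (E n) μ) {G : Ω → ℝ}
    (h : ∀ᵐ ω ∂μ, Tendsto (fun n => (μ⟦E n | m⟧) ω) atTop (𝓝 (G ω))) :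
    Integrable G μ ∧ Tendsto (fun n => μ.real (E n)) atTop (𝓝 (∫ ω, G ω ∂μ)) := by
  have hbdd : ∀ n, ∀ᵐ ω ∂μ, ‖(μ⟦E n | m⟧) ω‖ ≤ 1 := fun n => by
    refine ae_bdd_abs_condExp_of_ae_bdd_abs (R := 1) (ae_of_all _ fun ω => ?_)
    by_cases hω : ω ∈ E n <;> simp [hω]
  have hasm : ∀ n, AEStronglyMeasurable (μ⟦E n | m⟧) μ := fun n =>
    integrable_condExp.aestronglyMeasurable
  constructor
  -- `G` is not assumed measurable: it inherits measurability and the bound 1 as an a.e. limit.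
  · refine .of_bound (aestronglyMeasurable_of_tendsto_ae _ hasm h) 1 ?_
    filter_upwards [h, ae_all_iff.2 hbdd] with ω h1 h2
    exact le_of_tendsto h1.norm (.of_forall h2)
  · have := tendsto_integral_of_dominated_convergence (fun _ => (1 : ℝ)) hasm
      (integrable_const _) hbdd h
    refine this.congr fun n => ?_
    rw [integral_condExp hm, integral_indicator₀ (hE n)]
    simp

/-! ### From loss ratios of a random model to the frozen-model test. -/

section Audit

variable {k : ℕ} {X : Set (EuclideanSpace ℝ (Fin k))} {Y Θ Ω : Type*} [MeasurableSpace Y]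
  [MeasurableSpace Θ] [MeasurableSpace Ω] {loss : Y → Y → ℝ} {d : X → X → ℝ} {lam T : ℝ}
  {f : Θ → X → Y} {μ : Measure Ω} [IsProbabilityMeasure μ] {θ : Ω → Θ} {P : Measure (X × Y)}
  {Z : ℕ → Ω → X × Y} {h : Θ × (X × Y) → ℝ}

theorem measurableSet_reject (α δ : ℝ) (hh : Measurable h) (n : ℕ) :
    MeasurableSet {p : Θ × (ℕ → X × Y) | δ < testStatistic α (fun i => h (p.1, p.2 i)) n} :=
  measurableSet_lt measurable_const <| (measurable_testStatistic α n).comp <|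
    measurable_pi_lambda _ fun i => hh.comp
      (measurable_fst.prodMk ((measurable_pi_apply i).comp measurable_snd))

/-- Each `(θ, Z i)` has law `(μ.map θ).prod P`, so the loss ratio may be replaced by `h` at all
countably many sample points at once. -/
theorem rejectionEvent_ae_eq (α δ : ℝ) (hθ : Measurable θ) (hZ : ∀ i, Measurable (Z i))
    (hlaw : ∀ i, μ.map (Z i) = P) (hindep : IndepFun θ (fun ω i => Z i ω) μ)
    (hae : (fun p : Θ × (X × Y) => lossRatio loss (f p.1) d lam T p.2)
      =ᵐ[(μ.map θ).prod P] h) (n : ℕ) :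
    rejectionEvent loss d lam T α δ (fun ω => f (θ ω)) Z n
      =ᵐ[μ] (fun ω => (θ ω, fun i => Z i ω)) ⁻¹'
        {p | δ < testStatistic α (fun i => h (p.1, p.2 i)) n} := by
  have hpair : ∀ i, ∀ᵐ ω ∂μ, lossRatio loss (f (θ ω)) d lam T (Z i ω) = h (θ ω, Z i ω) := by
    intro i
    have hi : IndepFun θ (Z i) μ := hindep.comp measurable_id (measurable_pi_apply i)
    have hmap := (indepFun_iff_map_prod_eq_prod_map_map hθ.aemeasurable (hZ i).aemeasurable).1 hi
    rw [hlaw i] at hmap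
    rw [← hmap] at hae
    exact ae_of_ae_map (hθ.prodMk (hZ i)).aemeasurable hae
  rw [eventuallyEq_set]
  filter_upwards [ae_all_iff.2 hpair] with ω hω
  simp [rejectionEvent, hω]

theorem ae_condExp_rejectionEvent (α δ : ℝ) (hθ : Measurable θ) (hZ : ∀ i, Measurable (Z i))
    (hlaw : ∀ i, μ.map (Z i) = P) (hindep : IndepFun θ (fun ω i => Z i ω) μ)
    (hh : Measurable h)
    (hae : (fun p : Θ × (X × Y) => lossRatio loss (f p.1) d lam T p.2)
      =ᵐ[(μ.map θ).prod P] h) :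
    ∀ᵐ ω ∂μ, ∀ n, (μ⟦rejectionEvent loss d lam T α δ (fun ω => f (θ ω)) Z n |
        MeasurableSpace.comap θ inferInstance⟧) ω
      = μ.real {ω' | δ < testStatistic α (fun i => h (θ ω, Z i ω')) n} := by
  refine ae_all_iff.2 fun n => ?_
  have hcongr := condExp_congr_ae (m := MeasurableSpace.comap θ inferInstance)
    (indicator_ae_eq_of_ae_eq_set (f := fun _ => (1 : ℝ))
      (rejectionEvent_ae_eq α δ hθ hZ hlaw hindep hae n))
  exact hcongr.trans (condExp_indicator_preimage_of_indepFun hθ (measurable_pi_lambda _ hZ)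
    hindep (measurableSet_reject α δ hh n))

/-- The limits of the conditional rejection probabilities given the model. -/
theorem ae_tendsto_condExp_rejectionEvent [IsProbabilityMeasure P] {α : ℝ} (δ : ℝ) (hα : α ∈ Ioo (0 : ℝ) 1)
    (hθ : Measurable θ) (hZ : ∀ i, Measurable (Z i)) (hlaw : ∀ i, μ.map (Z i) = P)
    (hiid : iIndepFun Z μ) (hindep : IndepFun θ (fun ω i => Z i ω) μ) (hh : Measurable h)
    (hae : (fun p : Θ × (X × Y) => lossRatio loss (f p.1) d lam T p.2)
      =ᵐ[(μ.map θ).prod P] h)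
    (hmom : ∀ᵐ ω ∂μ, MemLp (lossRatio loss (f (θ ω)) d lam T) 2 P) :
    ∀ᵐ ω ∂μ,
      (auditValue loss (f (θ ω)) d lam T P ≤ δ →
        ∃ p : ℝ, p ≤ α ∧ Tendsto
          (fun n => (μ⟦rejectionEvent loss d lam T α δ (fun ω => f (θ ω)) Z n |
            MeasurableSpace.comap θ inferInstance⟧) ω) atTop (𝓝 p)) ∧
      (δ < auditValue loss (f (θ ω)) d lam T P →
        Tendsto
          (fun n => (μ⟦rejectionEvent loss d lam T α δ (fun ω => f (θ ω)) Z n |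
            MeasurableSpace.comap θ inferInstance⟧) ω) atTop (𝓝 1)) := by
  -- For almost every model the section of `h` is a measurable version of the loss ratio, so moments
  -- and audit value transfer to it.
  have hsec : ∀ᵐ ω ∂μ, ∀ᵐ z ∂P, lossRatio loss (f (θ ω)) d lam T z = h (θ ω, z) :=
    ae_of_ae_map hθ.aemeasurable (Measure.ae_ae_of_ae_prod hae)
  filter_upwards [ae_condExp_rejectionEvent α δ hθ hZ hlaw hindep hh hae, hsec, hmom]
    with ω hω hsecω hmomω
  simp_rw [hω]
  have hhω : Measurable fun z => h (θ ω, z) := hh.comp measurable_prodMk_left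
  have hm : ∀ i, Measurable fun ω' => h (θ ω, Z i ω') := fun i => hhω.comp (hZ i)
  have hind : iIndepFun (fun i ω' => h (θ ω, Z i ω')) μ := hiid.comp (fun _ z => h (θ ω, z))
    fun _ => hhω
  have hident : ∀ i, IdentDistrib (fun ω' => h (θ ω, Z i ω')) (fun ω' => h (θ ω, Z 0 ω')) μ μ :=
    fun i => IdentDistrib.comp (f := Z i) (g := Z 0) ⟨(hZ i).aemeasurable, (hZ 0).aemeasurable,
      (hlaw i).trans (hlaw 0).symm⟩ hhω
  have hL2 : MemLp (fun ω' => h (θ ω, Z 0 ω')) 2 μ := by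
    refine MemLp.comp_of_map (g := fun z => h (θ ω, z)) ?_ (hZ 0).aemeasurable
    rw [hlaw 0]
    exact hmomω.ae_eq hsecω
  have hmean : ∫ ω', h (θ ω, Z 0 ω') ∂μ = auditValue loss (f (θ ω)) d lam T P := by
    rw [auditValue, integral_congr_ae hsecω, ← hlaw 0,
      integral_map (hZ 0).aemeasurable hhω.aestronglyMeasurable]
  constructor
  · intro hle
    exact exists_tendsto_measureReal_reject hα hm hind hident hL2 (hmean.trans_le hle)
  · intro hlt
    simpa only [hmean, if_pos hlt] using
      tendsto_measureReal_reject_of_ne α hm hind hident hL2 (hmean.trans_ne hlt.ne')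

end Audit

theorem corollary2 {k : ℕ} {X : Set (EuclideanSpace ℝ (Fin k))} (hX : UniqueDiffOn ℝ X)
    {Y Θ Ω : Type*} [MeasurableSpace Y] [MeasurableSpace Θ] [MeasurableSpace Ω]
    -- the loss, the fair metric, and the parameters of the attack and of the test
    (loss : Y → Y → ℝ) (hloss : ∀ u y, 0 ≤ loss u y)
    (d : X → X → ℝ) (hd : IsFairMetric d)
    (lam T α δ : ℝ) (hlam : 0 ≤ lam) (hT : 0 < T) (hα : α ∈ Ioo (0 : ℝ) 1)
    -- the ML model `f (θ ω)`, possibly random through its parameter `θ`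
    (f : Θ → X → Y) (μ : Measure Ω) [IsProbabilityMeasure μ] (θ : Ω → Θ) (hθ : Measurable θ)
    -- an i.i.d. audit sample from `P`, independent of the model
    (P : Measure (X × Y)) [IsProbabilityMeasure P] (Z : ℕ → Ω → X × Y)
    (hZ : ∀ i, Measurable (Z i)) (hlaw : ∀ i, μ.map (Z i) = P) (hiid : iIndepFun Z μ)
    (hindep : IndepFun θ (fun ω i => Z i ω) μ)
    -- the loss ratio is (jointly) measurable
    (hmeas : AEMeasurable (fun p : Θ × (X × Y) => lossRatio loss (f p.1) d lam T p.2)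
      ((μ.map θ).prod P))
    -- assumptions on the model
    (hpos : ∀ᵐ ω ∂μ, ∀ᵐ z ∂P, 0 < loss (f (θ ω) z.1) z.2)
    (hLip : ∀ᵐ ω ∂μ, HasLipschitzGradient loss (f (θ ω)) d lam)
    (hmom : ∀ᵐ ω ∂μ, MemLp (lossRatio loss (f (θ ω)) d lam T) 2 P) :
    -- limiting rejection probability
    ((∀ᵐ ω ∂μ, auditValue loss (f (θ ω)) d lam T P ≤ δ) →
      ∃ p : ℝ, p ≤ α ∧ Tendsto
        (fun n => μ.real (rejectionEvent loss d lam T α δ (fun ω => f (θ ω)) Z n))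
        atTop (𝓝 p)) ∧
    ((∀ᵐ ω ∂μ, δ < auditValue loss (f (θ ω)) d lam T P) →
      Tendsto (fun n => μ.real (rejectionEvent loss d lam T α δ (fun ω => f (θ ω)) Z n))
        atTop (𝓝 1)) ∧
    -- the same conditionally on the model
    (∀ᵐ ω ∂μ,
      (auditValue loss (f (θ ω)) d lam T P ≤ δ →
        ∃ p : ℝ, p ≤ α ∧ Tendsto
          (fun n => (μ⟦rejectionEvent loss d lam T α δ (fun ω => f (θ ω)) Z n |
            MeasurableSpace.comap θ inferInstance⟧) ω) atTop (𝓝 p)) ∧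
      (δ < auditValue loss (f (θ ω)) d lam T P →
        Tendsto
          (fun n => (μ⟦rejectionEvent loss d lam T α δ (fun ω => f (θ ω)) Z n |
            MeasurableSpace.comap θ inferInstance⟧) ω) atTop (𝓝 1))) := by
  have hZs : Measurable fun ω i => Z i ω := measurable_pi_lambda _ hZ
  have hcond := ae_tendsto_condExp_rejectionEvent δ hα hθ hZ hlaw hiid hindep hmeas.measurable_mk
    hmeas.ae_eq_mk hmom
  have hE : ∀ n, NullMeasurableSet
      (rejectionEvent loss d lam T α δ (fun ω => f (θ ω)) Z n) μ := fun n =>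
    ((hθ.prodMk hZs) (measurableSet_reject α δ hmeas.measurable_mk n)).nullMeasurableSet.congr
      (rejectionEvent_ae_eq α δ hθ hZ hlaw hindep hmeas.ae_eq_mk n).symm
  refine ⟨fun hle => ?_, fun hlt => ?_, hcond⟩
  · have hex : ∀ᵐ ω ∂μ, ∃ p : ℝ, p ≤ α ∧ Tendsto
        (fun n => (μ⟦rejectionEvent loss d lam T α δ (fun ω => f (θ ω)) Z n |
          MeasurableSpace.comap θ inferInstance⟧) ω) atTop (𝓝 p) := by
      filter_upwards [hcond, hle] with ω h1 h2 using h1.1 h2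
    -- The limits are chosen pointwise in `ω`; `tendsto_measureReal_of_condExp` supplies
    -- integrability of the choice, and its mean is then at most `α`.
    obtain ⟨G, hG⟩ := hex.choice
    obtain ⟨hGint, hlim⟩ := tendsto_measureReal_of_condExp hθ.comap_le hE
      (hG.mono fun ω h => h.2)
    refine ⟨_, ?_, hlim⟩
    have := integral_mono_ae hGint (integrable_const α) (hG.mono fun ω h => h.1)
    simpa using this
  · have := (tendsto_measureReal_of_condExp (G := fun _ => 1) hθ.comap_le hE (by
      filter_upwards [hcond, hlt] with ω h1 h2 using h1.2 h2)).2
    simpa using this
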